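/- For a continuous map $f\colon X\to Y$, let $\operatorname{cat}(f)\in\{0,1,2,\dots\}\cup\{\infty\}$ be the least $k$ such that $X$ has an open cover $U_0,\dots,U_k$ with each restriction $f|_{U_i}\colon U_i\to Y$ null-homotopic ($\infty$ if there is no such $k$). For a homomorphism $\varphi\colon\Gamma\to\Lambda$ of discrete groups, let $\operatorname{cat}(\varphi)=\operatorname{cat}(B\varphi)$, where $B\varphi\colon B\Gamma\to B\Lambda$ is the induced map of classifying spaces (geometric realizations of the nerves of the groups), and let $\operatorname{cd}(\varphi)$ be the maximum (or $\infty$) of the $k\ge 0$ for which there is a $\mathbb{Z}\Lambda$-module $M$ such that the induced homomorphism $\varphi^*\colon H^k(\Lambda,M)\to H^k(\Gamma,M)$ is nonzero, where $\Gamma$ acts on $M$ through $\varphi$. Let $F_n$ and $F_m$ be free groups of finite ranks $n$ and $m$ with $m\ge 1$, and let $\varphi\colon F_n\to F_m$ be an epimorphism. Then $\operatorname{cat}(\varphi)=\operatorname{cd}(\varphi)=1$. -/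

import Mathlib

open CategoryTheory

/-- The Lusternik-Schnirelmann category of a continuous map `f : X → Y`: the least `k` such that
`X` has an open cover by `k + 1` sets `U 0, …, U k` with each restriction `f|_{U i}`
null-homotopic as a map `U i → Y`; it is `⊤` if there is no such `k`. -/
noncomputable def LSCategory {X Y : Type*} [TopologicalSpace X] [TopologicalSpace Y]
    (f : C(X, Y)) : ℕ∞ :=
  sInf {c : ℕ∞ | ∃ k : ℕ, c = k ∧ ∃ U : Fin (k + 1) → Set X,
    (∀ i, IsOpen (U i)) ∧ (⋃ i, U i) = Set.univ ∧ ∀ i, (f.restrict (U i)).Nullhomotopic}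

/-- The classifying space `BΓ = K(Γ, 1)` of a discrete group `Γ`: the geometric realization of
the nerve of the one-object category with automorphism group `Γ`. -/
noncomputable abbrev ClassifyingSpace (Γ : Type) [Group Γ] : TopCat.{0} :=
  SSet.toTop.obj (nerve (SingleObj Γ))

/-- The continuous map `Bφ : BΓ → BΛ` induced by a group homomorphism `φ : Γ → Λ`. -/
noncomputable def classifyingMap {Γ Λ : Type} [Group Γ] [Group Λ] (φ : Γ →* Λ) :
    C(ClassifyingSpace Γ, ClassifyingSpace Λ) :=
  (SSet.toTop.map (nerveMap (SingleObj.mapHom Γ Λ φ))).hom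

/-- The Lusternik-Schnirelmann category of a group homomorphism, `cat φ = cat (Bφ)`. -/
noncomputable def homCat {Γ Λ : Type} [Group Γ] [Group Λ] (φ : Γ →* Λ) : ℕ∞ :=
  LSCategory (classifyingMap φ)

/-- The cohomological dimension of a group homomorphism `φ : Γ → Λ`: the maximum (in `ℕ∞`) of
the `k` for which there is a `Λ`-module `M` such that the induced homomorphism
`φ^* : H^k(Λ, M) → H^k(Γ, M)` is nonzero, where `Γ` acts on `M` through `φ`. -/
noncomputable def homCd {Γ Λ : Type} [Group Γ] [Group Λ] (φ : Γ →* Λ) : ℕ∞ :=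
  sSup {d : ℕ∞ | ∃ k : ℕ, d = k ∧ ∃ M : Rep.{0} ℤ Λ,
    groupCohomology.map φ (𝟙 (Rep.res φ M)) k ≠ 0}

/-! Upper bound for the category: a point of the universal cover of `BF`, `F` free of finite rank,
is a weighted family of vertices `v i` of `F`; its cost at `x` is the weighted sum of the squared
tree distances from `x` to the `v i`. Squared distance is strictly convex along geodesics of the
Cayley tree (`exists_stewart_le`), so any two minima are adjacent, and a tree has no triangles.
Hence the minimum is attained at one vertex or at the two ends of one edge. Each alternative implies
an open, translation-invariant condition that selects a vertex (for an edge, its initial end), and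
the straight paths to the selected vertices descend to a contraction in `BF`
(`exists_isOpen_nullhomotopic`). The two resulting open sets cover `BF`; composing with `Bφ` gives
category at most `1`.

Upper bound for the dimension: crossed homomorphisms on a free group are free on the generators, so
`H^1` preserves epimorphisms, and dimension shifting kills `H^k` for `k ≥ 2`.

Both lower bounds use the exponent sum `ψ`, which by surjectivity is nontrivial on some `φ g`. It
yields a loop of nonzero winding number in the circle, and a class in `H^1` with trivial integer
coefficients whose pullback is nonzero. -/

namespace Realization

/-! ### Maps out of a geometric realization -/

open Opposite

/-- The characteristic map `Δ^n → |X|` of an `n`-simplex of a simplicial set `X`. -/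
noncomputable def charMap {X : SSet.{0}} {n : SimplexCategory} (σ : X.obj (op n)) :
    C(stdSimplex ℝ (Fin (n.len + 1)), SSet.toTop.obj X) :=
  TopCat.toSSetObjEquiv _ _ ((sSetTopAdj.unit.app X).app _ σ)

theorem charMap_map {X : SSet.{0}} {n m : SimplexCategory} (θ : m ⟶ n) (σ : X.obj (op n))
    (t : stdSimplex ℝ (Fin (m.len + 1))) :
    charMap (X.map θ.op σ) t = charMap σ (stdSimplex.map θ t) := by
  have h := congr($((sSetTopAdj.unit.app X).naturality θ.op) σ)
  unfold charMap
  erw [h]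
  rfl

theorem toTop_map_charMap {X Y : SSet.{0}} (f : X ⟶ Y) {n : SimplexCategory} (σ : X.obj (op n))
    (t : stdSimplex ℝ (Fin (n.len + 1))) :
    (SSet.toTop.map f) (charMap σ t) = charMap (f.app _ σ) t := by
  have h := congr(($(sSetTopAdj.unit.naturality f)).app (op n) σ)
  unfold charMap
  erw [h]
  rfl

/-- A continuous map out of a geometric realization is given by a compatible family of maps on
the simplices. -/
theorem exists_realization_lift {X : SSet.{0}} {Y : Type} [TopologicalSpace Y]
    (h : ∀ n : SimplexCategory, X.obj (op n) → C(stdSimplex ℝ (Fin (n.len + 1)), Y))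
    (hh : ∀ (n m : SimplexCategory) (θ : m ⟶ n) (σ : X.obj (op n)) t,
      h m (X.map θ.op σ) t = h n σ (stdSimplex.map θ t)) :
    ∃ g : C(SSet.toTop.obj X, Y), ∀ (n : SimplexCategory) (σ : X.obj (op n)) t,
      g (charMap σ t) = h n σ t := by
  let F : X ⟶ TopCat.toSSet.obj (TopCat.of Y) :=
    { app := fun n => TypeCat.ofHom fun σ =>
        (TopCat.toSSetObjEquiv (TopCat.of Y) n).symm (h n.unop σ)
      naturality := by
        intro n m θ
        ext σ
        apply (TopCat.toSSetObjEquiv (TopCat.of Y) m).injective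
        ext t
        exact (hh _ _ θ.unop σ t) }
  refine ⟨((sSetTopAdj.homEquiv X (TopCat.of Y)).symm F).hom, fun n σ t => ?_⟩
  have h1 := (sSetTopAdj.homEquiv X (TopCat.of Y)).apply_symm_apply F
  rw [Adjunction.homEquiv_unit] at h1
  have h2 := congr(TopCat.toSSetObjEquiv (TopCat.of Y) (op n) (($h1).app (op n) σ) t)
  exact h2

theorem realization_hom_ext {X : SSet.{0}} {Y : Type} [TopologicalSpace Y]
    {f g : C(SSet.toTop.obj X, Y)}
    (h : ∀ (n : SimplexCategory) (σ : X.obj (op n)) t, f (charMap σ t) = g (charMap σ t)) :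
    f = g := by
  have : TopCat.ofHom f = TopCat.ofHom (Y := Y) g := by
    apply (sSetTopAdj.homEquiv X (TopCat.of Y)).injective
    rw [Adjunction.homEquiv_unit, Adjunction.homEquiv_unit]
    ext n σ
    apply (TopCat.toSSetObjEquiv (TopCat.of Y) n).injective
    ext t
    exact h n.unop σ t
  exact congr(($this).hom)

/-- Every indicator function into the indiscrete two-point space is continuous, so
`realization_hom_ext` identifies the indicator of the union of the simplices with the constant
`true`. -/
theorem exists_charMap_eq {X : SSet.{0}} (u : SSet.toTop.obj X) :
    ∃ (n : SimplexCategory) (σ : X.obj (op n)) (t : stdSimplex ℝ (Fin (n.len + 1))),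
      charMap σ t = u := by
  let S : Set (SSet.toTop.obj X) :=
    {u | ∃ (n : SimplexCategory) (σ : X.obj (op n)) (t : stdSimplex ℝ (Fin (n.len + 1))),
      charMap σ t = u}
  let _ : TopologicalSpace Bool := ⊤
  classical
  let f : C(SSet.toTop.obj X, Bool) := ⟨fun u => decide (u ∈ S), continuous_top⟩
  let g : C(SSet.toTop.obj X, Bool) := ⟨fun _ => true, continuous_top⟩
  have hfg : f = g := realization_hom_ext fun n σ t => by
    simp only [f, g, ContinuousMap.coe_mk, decide_eq_true_eq]
    exact ⟨n, σ, t, rfl⟩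
  have := congr($hfg u)
  exact of_decide_eq_true this

end Realization

/-! ### Partial maps with open domain -/

/-- The space `Y` with a generic point `none` added, whose only neighbourhood is the whole space.
Continuous maps `X → PartialPoint Y` are partial maps `X → Y` with open domain. -/
def PartialPoint (Y : Type*) : Type _ := Option Y

namespace PartialPoint

variable {X Y : Type*} [TopologicalSpace X] [TopologicalSpace Y]

instance : TopologicalSpace (PartialPoint Y) where
  IsOpen O := (none ∈ O → O = Set.univ) ∧ IsOpen {y : Y | (some y : Option Y) ∈ O}
  isOpen_univ := ⟨fun _ => rfl, isOpen_univ⟩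
  isOpen_inter s t hs ht := by
    refine ⟨fun h => ?_, hs.2.inter ht.2⟩
    rw [hs.1 h.1, ht.1 h.2, Set.univ_inter]
  isOpen_sUnion S hS := by
    refine ⟨fun ⟨s, hs, h⟩ => ?_, ?_⟩
    · exact Set.eq_univ_of_univ_subset ((hS s hs).1 h ▸ Set.subset_sUnion_of_mem hs)
    · have : {y : Y | (some y : Option Y) ∈ ⋃₀ S} = ⋃ s ∈ S, {y : Y | (some y : Option Y) ∈ s} := by
        ext y
        simp only [Set.mem_iUnion, exists_prop]
        rfl
      rw [this]
      exact isOpen_biUnion fun s hs => (hS s hs).2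

theorem continuous_of_forall_isOpen {g : X → PartialPoint Y}
    (h : ∀ V : Set Y, IsOpen V → IsOpen {x | ∃ y ∈ V, g x = (some y : Option Y)}) :
    Continuous g := by
  refine ⟨fun O hO => ?_⟩
  by_cases hn : none ∈ O
  · rw [hO.1 hn]
    exact isOpen_univ
  · convert h _ hO.2 using 1
    ext x
    simp only [Set.mem_preimage, Set.mem_ofPred_eq]
    rcases hx : g x with _ | y
    · exact ⟨fun h => absurd h hn, fun ⟨y, _, h⟩ => nomatch h⟩
    · exact ⟨fun h => ⟨y, h, rfl⟩, fun ⟨z, hz, h⟩ => by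
        rw [show (some y : Option Y) = some z from h]; exact hz⟩

theorem exists_partial_map (g : C(X, PartialPoint Y)) :
    ∃ U : Set X, IsOpen U ∧ (∀ x, x ∈ U ↔ ∃ y, g x = (some y : Option Y)) ∧
      ∃ f : C(U, Y), ∀ u : U, g u = (some (f u) : Option Y) := by
  have ho : ∀ V : Set Y, IsOpen V → IsOpen {x | ∃ y ∈ V, g x = (some y : Option Y)} := by
    intro V hV
    have : {x | ∃ y ∈ V, g x = (some y : Option Y)} = g ⁻¹' (some '' V : Set (Option Y)) := by
      ext x
      constructor
      · rintro ⟨y, hy, h⟩; exact ⟨y, hy, h.symm⟩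
      · rintro ⟨y, hy, h⟩; exact ⟨y, hy, h.symm⟩
    rw [this]
    refine IsOpen.preimage g.continuous ⟨?_, ?_⟩
    · rintro ⟨y, _, h⟩
      exact nomatch h
    · convert hV using 1
      ext y
      constructor
      · rintro ⟨z, hz, h⟩; exact Option.some.inj h ▸ hz
      · exact fun hy => ⟨y, hy, rfl⟩
  choose f hf using fun u : {x | ∃ y ∈ Set.univ, g x = (some y : Option Y)} => u.2
  refine ⟨_, ho Set.univ isOpen_univ, fun x => by simp, ⟨f, ⟨fun V hV => ?_⟩⟩, fun u => (hf u).2⟩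
  convert (ho V hV).preimage continuous_subtype_val using 1
  ext u
  constructor
  · exact fun hu => ⟨f u, hu, (hf u).2⟩
  · rintro ⟨y, hy, h⟩
    have := (hf u).2.symm.trans h
    rw [Set.mem_preimage, Option.some.inj this]
    exact hy

end PartialPoint

/-! ### Cones in standard simplices -/

namespace stdSimplex

/-- The point at parameter `s` on the segment from `t`, in the face opposite to the vertex `0`,
to the vertex `0`. -/
def cone {n : ℕ} (s : unitInterval) (t : stdSimplex ℝ (Fin n)) : stdSimplex ℝ (Fin (n + 1)) :=
  ⟨Fin.cons (s : ℝ) fun i => (1 - s) * t i, by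
    constructor
    · intro i
      refine Fin.cases s.2.1 (fun i => ?_) i
      exact mul_nonneg (sub_nonneg.2 s.2.2) (t.2.1 i)
    · rw [Fin.sum_univ_succ]
      simp [← Finset.mul_sum]⟩

theorem continuous_cone {n : ℕ} :
    Continuous fun p : stdSimplex ℝ (Fin n) × unitInterval => cone p.2 p.1 := by
  refine Continuous.subtype_mk (continuous_pi fun i => ?_) _
  refine Fin.cases ?_ (fun i => ?_) i
  · exact continuous_subtype_val.comp continuous_snd
  · simp only [Fin.cons_succ]
    refine (continuous_const.sub (continuous_subtype_val.comp continuous_snd)).mul ?_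
    exact ((continuous_apply i).comp continuous_subtype_val).comp continuous_fst

theorem map_apply {n m : ℕ} (f : Fin n → Fin m) (t : stdSimplex ℝ (Fin n)) (j : Fin m) :
    map f t j = ∑ i, if f i = j then t i else 0 := by
  rw [map_coe, FunOnFinite.linearMap_apply_apply, Finset.sum_filter]

theorem sum_map_mul {n m : ℕ} (f : Fin n → Fin m) (t : stdSimplex ℝ (Fin n)) (w : Fin m → ℝ) :
    ∑ j, map f t j * w j = ∑ i, t i * w (f i) := by
  simp_rw [map_apply, Finset.sum_mul, ite_mul, zero_mul]
  rw [Finset.sum_comm]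
  simp

theorem map_cone {n m : ℕ} (f : Fin n → Fin m) (s : unitInterval) (t : stdSimplex ℝ (Fin n)) :
    map (Fin.cons 0 (Fin.succ ∘ f) : Fin (n + 1) → Fin (m + 1)) (cone s t) = cone s (map f t) := by
  ext j
  rw [map_apply, Fin.sum_univ_succ]
  refine Fin.cases ?_ (fun j => ?_) j
  · change (if (0 : Fin (m + 1)) = 0 then (s : ℝ) else 0) +
      ∑ i : Fin n, (if (f i).succ = (0 : Fin (m + 1)) then (1 - (s : ℝ)) * t i else 0) = (s : ℝ)
    simp [Fin.succ_ne_zero]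
  · change _ = (1 - (s : ℝ)) * map f t j
    rw [map_apply, Finset.mul_sum]
    change (if (0 : Fin (m + 1)) = j.succ then (s : ℝ) else 0) +
      ∑ i : Fin n, (if (f i).succ = j.succ then (1 - (s : ℝ)) * t i else 0) = _
    simp [Fin.succ_inj, (Fin.succ_ne_zero _).symm]

theorem cone_zero {n : ℕ} (t : stdSimplex ℝ (Fin n)) : cone 0 t = map Fin.succ t := by
  ext j
  rw [map_apply]
  refine Fin.cases ?_ (fun j => ?_) j
  · change (0 : ℝ) = _
    simp
  · change (1 - (0 : ℝ)) * t j = _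
    simp

theorem cone_one {n : ℕ} (t : stdSimplex ℝ (Fin n)) :
    cone 1 t = map (fun _ : Fin 1 => 0) default := by
  ext j
  rw [map_apply]
  refine Fin.cases ?_ (fun j => ?_) j
  · change (1 : ℝ) = _
    simp
  · change (1 - (1 : ℝ)) * t j = _
    simp [(Fin.succ_ne_zero _).symm]

end stdSimplex

/-! ### Homogeneous coordinates on the classifying space -/

namespace Realization

open Opposite

variable {G : Type} [Group G]

theorem nerve_singleObj_ext {n : SimplexCategory} {σ τ : Fin (n.len + 1) ⥤ SingleObj G}
    (h : ∀ (i j : Fin (n.len + 1)) (f : i ⟶ j), (σ.map f : G) = τ.map f) : σ = τ := by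
  refine CategoryTheory.Functor.ext (fun _ => rfl) fun i j f => ?_
  rw [eqToHom_refl]
  exact (h i j f).trans ((one_mul (M := G) _).symm.trans (mul_one (M := G) _).symm)

/-- The simplex of the nerve of `G` that is the image of the simplex with vertices
`v 0, …, v n` of the universal cover. -/
def bar {n : SimplexCategory} (v : Fin (n.len + 1) → G) : (nerve (SingleObj G)).obj (op n) :=
  SingleObj.differenceFunctor v

theorem nerveMap_bar {H : Type} [Group H] (φ : G →* H) {n : SimplexCategory}
    (v : Fin (n.len + 1) → G) :
    (nerveMap (SingleObj.mapHom G H φ)).app (op n) (bar v) = bar fun i => φ (v i) :=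
  nerve_singleObj_ext fun i j f => by
    change φ (v j * (v i)⁻¹) = φ (v j) * (φ (v i))⁻¹
    rw [map_mul, map_inv]

theorem bar_mul_right {n : SimplexCategory} (v : Fin (n.len + 1) → G) (g : G) :
    (bar fun i => v i * g) = bar v :=
  nerve_singleObj_ext fun i j f => by
    change v j * g * (v i * g)⁻¹ = v j * (v i)⁻¹
    group

/-- The vertices of the lift of a simplex of the nerve to the universal cover with initial
vertex `1`. -/
def vert {n : SimplexCategory} (σ : (nerve (SingleObj G)).obj (op n)) (i : Fin (n.len + 1)) : G :=
  CategoryTheory.Functor.map (C := Fin (n.len + 1)) (D := SingleObj G) σ (homOfLE (Fin.zero_le i))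

theorem bar_vert {n : SimplexCategory} (σ : (nerve (SingleObj G)).obj (op n)) :
    bar (vert σ) = σ :=
  nerve_singleObj_ext fun i j f => by
    change vert σ j * (vert σ i)⁻¹ = _
    rw [mul_inv_eq_iff_eq_mul]
    exact CategoryTheory.Functor.map_comp (C := Fin (n.len + 1)) (D := SingleObj G) σ
      (homOfLE (Fin.zero_le i)) f

theorem vert_bar {n : SimplexCategory} (v : Fin (n.len + 1) → G) (i) :
    vert (bar v) i = v i * (v 0)⁻¹ := rfl

theorem vert_map {n m : SimplexCategory} (θ : m ⟶ n) (σ : (nerve (SingleObj G)).obj (op n))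
    (i : Fin (m.len + 1)) :
    vert ((nerve (SingleObj G)).map θ.op σ) i = vert σ (θ i) * (vert σ (θ 0))⁻¹ := by
  conv_lhs => rw [← bar_vert σ]
  rfl

/-- The characteristic map of the simplex with vertices `v`. -/
noncomputable def barMap {n : ℕ} (v : Fin (n + 1) → G) :
    C(stdSimplex ℝ (Fin (n + 1)), ClassifyingSpace G) :=
  charMap (n := SimplexCategory.mk n) (bar v)

theorem barMap_comp {n m : ℕ} (f : Fin (m + 1) → Fin (n + 1)) (hf : Monotone f)
    (v : Fin (n + 1) → G) (t : stdSimplex ℝ (Fin (m + 1))) :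
    barMap (fun i => v (f i)) t = barMap v (stdSimplex.map f t) :=
  charMap_map (SimplexCategory.mkHom ⟨f, hf⟩) (bar (n := SimplexCategory.mk n) v) t

theorem barMap_mul_right {n : ℕ} (v : Fin (n + 1) → G) (g : G) :
    (barMap fun i => v i * g) = barMap v :=
  congrArg charMap (bar_mul_right (n := SimplexCategory.mk n) v g)

theorem classifyingMap_barMap {H : Type} [Group H] (φ : G →* H) {n : ℕ} (v : Fin (n + 1) → G)
    (t : stdSimplex ℝ (Fin (n + 1))) :
    classifyingMap φ (barMap v t) = barMap (fun i => φ (v i)) t :=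
  (toTop_map_charMap _ _ t).trans (congrArg (charMap · t) (nerveMap_bar φ _))

theorem exists_barMap_eq (u : ClassifyingSpace G) :
    ∃ (n : ℕ) (v : Fin (n + 1) → G) (t : stdSimplex ℝ (Fin (n + 1))), barMap v t = u := by
  obtain ⟨n, σ, t, rfl⟩ := exists_charMap_eq u
  exact ⟨n.len, vert σ, t, congrArg (charMap · t) (bar_vert σ)⟩

/-- A continuous map out of `BG` is given by a family of maps on the simplices of the universal
cover that is compatible with the simplicial operators and invariant under `G`. -/
theorem exists_classifyingSpace_lift {Y : Type} [TopologicalSpace Y]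
    (h : ∀ n : ℕ, (Fin (n + 1) → G) → C(stdSimplex ℝ (Fin (n + 1)), Y))
    (hcomp : ∀ (n m : ℕ) (f : Fin (m + 1) → Fin (n + 1)), Monotone f → ∀ v t,
      h m (fun i => v (f i)) t = h n v (stdSimplex.map f t))
    (hmul : ∀ (n : ℕ) (v : Fin (n + 1) → G) (g : G) (t), h n (fun i => v i * g) t = h n v t) :
    ∃ F : C(ClassifyingSpace G, Y), ∀ (n : ℕ) (v : Fin (n + 1) → G) t,
      F (barMap v t) = h n v t := by
  obtain ⟨F, hF⟩ := exists_realization_lift (X := nerve (SingleObj G)) (Y := Y)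
    (fun n σ => h n.len (vert σ)) fun n m θ σ t => by
      -- Passing to a face renormalizes the initial vertex to `1` by a right translation, which
      -- invariance absorbs.
      rw [funext (vert_map θ σ), hmul _ (fun i => vert σ (θ i))]
      exact hcomp _ _ (fun i => θ i) θ.toOrderHom.monotone _ t
  refine ⟨F, fun n v t => ?_⟩
  refine (hF (SimplexCategory.mk n) _ t).trans ?_
  rw [funext (vert_bar (n := SimplexCategory.mk n) v)]
  exact hmul _ _ _ _

end Realization

/-! ### Costs, and contraction along straight paths -/

namespace Realization

variable {G : Type} [Group G]

/-- The total cost of reaching the vertices `v i` with weights `t i` from `x`, for a cost function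
`c` on `G`. -/
def cost (c : G → ℝ) {n : ℕ} (v : Fin (n + 1) → G) (t : stdSimplex ℝ (Fin (n + 1))) (x : G) : ℝ :=
  ∑ i, t i * c (x * (v i)⁻¹)

theorem cost_comp (c : G → ℝ) {n m : ℕ} (f : Fin (m + 1) → Fin (n + 1)) (v : Fin (n + 1) → G)
    (t : stdSimplex ℝ (Fin (m + 1))) :
    cost c (fun i => v (f i)) t = cost c v (stdSimplex.map f t) := by
  ext x
  exact (stdSimplex.sum_map_mul f t fun j => c (x * (v j)⁻¹)).symm

theorem cost_mul_right (c : G → ℝ) {n : ℕ} (v : Fin (n + 1) → G) (g : G)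
    (t : stdSimplex ℝ (Fin (n + 1))) :
    cost c (fun i => v i * g) t = fun x => cost c v t (x * g⁻¹) := by
  ext x
  simp [cost, mul_assoc]

theorem continuous_cost (c : G → ℝ) {n : ℕ} (v : Fin (n + 1) → G) (x : G) :
    Continuous fun t => cost c v t x := by
  refine continuous_finsetSum _ fun i _ => Continuous.mul ?_ continuous_const
  exact (continuous_apply i).comp continuous_subtype_val

/-- The straight path in `BG` from a point of the simplex with vertices `v` to the vertex `x`. -/
noncomputable def coneMap {n : ℕ} (x : G) (v : Fin (n + 1) → G) :
    C(stdSimplex ℝ (Fin (n + 1)), C(unitInterval, ClassifyingSpace G)) :=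
  ContinuousMap.curry
    ⟨fun p => barMap (Fin.cons x v : Fin (n + 1 + 1) → G) (stdSimplex.cone p.2 p.1),
      (barMap _).continuous.comp stdSimplex.continuous_cone⟩

theorem coneMap_apply {n : ℕ} (x : G) (v : Fin (n + 1) → G) (t) (s : unitInterval) :
    coneMap x v t s = barMap (Fin.cons x v : Fin (n + 1 + 1) → G) (stdSimplex.cone s t) :=
  rfl

theorem coneMap_comp {n m : ℕ} (f : Fin (m + 1) → Fin (n + 1)) (hf : Monotone f) (x : G)
    (v : Fin (n + 1) → G) (t : stdSimplex ℝ (Fin (m + 1))) :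
    coneMap x (fun i => v (f i)) t = coneMap x v (stdSimplex.map f t) := by
  ext s
  rw [coneMap_apply, coneMap_apply, ← stdSimplex.map_cone, ← barMap_comp]
  · congr 2
    ext i
    refine Fin.cases ?_ (fun i => ?_) i
    · rfl
    · rfl
  · intro i j
    refine Fin.cases ?_ (fun i => ?_) i
    · exact fun _ => Fin.zero_le _
    · refine Fin.cases ?_ (fun j => ?_) j
      · exact fun h => absurd h (by simp)
      · exact fun h => Fin.succ_le_succ_iff.2 (hf (Fin.succ_le_succ_iff.1 h))

theorem coneMap_mul_right {n : ℕ} (x : G) (v : Fin (n + 1) → G) (g : G) :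
    coneMap (x * g) (fun i => v i * g) = coneMap x v := by
  ext t s
  rw [coneMap_apply, coneMap_apply, ← barMap_mul_right (Fin.cons x v : Fin (n + 1 + 1) → G) g]
  congr 2
  ext i
  refine Fin.cases ?_ (fun i => ?_) i
  · rfl
  · rfl

theorem coneMap_zero {n : ℕ} (x : G) (v : Fin (n + 1) → G) (t) : coneMap x v t 0 = barMap v t := by
  rw [coneMap_apply, stdSimplex.cone_zero, ← barMap_comp _ (Fin.strictMono_succ).monotone]
  rfl

theorem coneMap_one {n : ℕ} (x : G) (v : Fin (n + 1) → G) (t) :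
    coneMap x v t 1 = barMap (fun _ : Fin 1 => (1 : G)) default := by
  rw [coneMap_apply, stdSimplex.cone_one, ← barMap_comp (n := n + 1) (m := 0) _ monotone_const]
  -- All vertices of the universal cover are translates of `1`, so every path ends at the same base
  -- point of `BG`.
  rw [← barMap_mul_right (fun _ : Fin 1 => (1 : G)) x]
  simp

/-- A rule `W` that selects, invariantly and locally constantly, at most one element of `G` for
each point of the universal cover of `BG`, has as its domain an open subset of `BG` whose
inclusion is null-homotopic. -/
theorem exists_isOpen_nullhomotopic (c : G → ℝ) (W : (G → ℝ) → G → Prop)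
    (hu : ∀ f x y, W f x → W f y → x = y)
    (he : ∀ f x g, W f x → W (fun y => f (y * g)) (x * g⁻¹))
    (ho : ∀ (n : ℕ) (v : Fin (n + 1) → G) (x : G), IsOpen {t | W (cost c v t) x}) :
    ∃ U : Set (ClassifyingSpace G), IsOpen U ∧
      (∀ (n : ℕ) (v : Fin (n + 1) → G) t, barMap v t ∈ U ↔ ∃ x, W (cost c v t) x) ∧
      ((ContinuousMap.id (ClassifyingSpace G)).restrict U).Nullhomotopic := by
  classical
  let Y := C(unitInterval, ClassifyingSpace G)
  let h₀ (n : ℕ) (v : Fin (n + 1) → G) (t : stdSimplex ℝ (Fin (n + 1))) : PartialPoint Y :=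
    if h : ∃ x, W (cost c v t) x then (some (coneMap h.choose v t) : Option Y)
    else (none : Option Y)
  have hsome : ∀ {n : ℕ} {v : Fin (n + 1) → G} {t : stdSimplex ℝ (Fin (n + 1))} {x : G},
      W (cost c v t) x → h₀ n v t = (some (coneMap x v t) : Option Y) := by
    intro n v t x hx
    have h : ∃ x, W (cost c v t) x := ⟨x, hx⟩
    exact (dif_pos h).trans (congrArg (fun z => (some (coneMap z v t) : Option Y))
      (hu _ _ _ h.choose_spec hx))
  have hnone : ∀ {n : ℕ} {v : Fin (n + 1) → G} {t : stdSimplex ℝ (Fin (n + 1))},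
      (¬ ∃ x, W (cost c v t) x) → h₀ n v t = (none : Option Y) := by
    intro n v t h
    exact dif_neg h
  have hcont : ∀ (n : ℕ) (v : Fin (n + 1) → G), Continuous (h₀ n v) := by
    intro n v
    refine PartialPoint.continuous_of_forall_isOpen fun V hV => ?_
    have : {t | ∃ y ∈ V, h₀ n v t = (some y : Option Y)} =
        ⋃ x, {t | W (cost c v t) x} ∩ (coneMap x v) ⁻¹' V := by
      ext t
      simp only [Set.mem_iUnion]
      constructor
      · rintro ⟨y, hy, hty⟩
        by_cases h : ∃ x, W (cost c v t) x
        · obtain ⟨x, hx⟩ := h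
          refine ⟨x, hx, ?_⟩
          rw [Set.mem_preimage, Option.some.inj ((hsome hx).symm.trans hty)]
          exact hy
        · exact nomatch (hnone h).symm.trans hty
      · rintro ⟨x, hx, hxV⟩
        exact ⟨_, hxV, hsome hx⟩
    rw [this]
    exact isOpen_iUnion fun x => (ho n v x).inter (hV.preimage (coneMap x v).continuous)
  -- Gluing path-valued partial maps yields the open domain and the contraction on it at once.
  obtain ⟨F, hF⟩ := exists_classifyingSpace_lift (G := G) (Y := PartialPoint Y)
    (fun n v => ⟨h₀ n v, hcont n v⟩)
    (by
      intro n m f hf v t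
      simp only [ContinuousMap.coe_mk]
      by_cases h : ∃ x, W (cost c v (stdSimplex.map f t)) x
      · obtain ⟨x, hx⟩ := h
        rw [hsome hx, ← coneMap_comp f hf]
        exact hsome (by rwa [cost_comp])
      · rw [hnone h]
        exact hnone (by rwa [cost_comp]))
    (by
      intro n v g t
      simp only [ContinuousMap.coe_mk]
      by_cases h : ∃ x, W (cost c v t) x
      · obtain ⟨x, hx⟩ := h
        rw [hsome hx, ← coneMap_mul_right x v g]
        refine hsome ?_
        rw [cost_mul_right]
        simpa using he _ x g⁻¹ hx
      · rw [hnone h]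
        refine hnone fun ⟨x, hx⟩ => h ⟨x * g⁻¹, ?_⟩
        rw [cost_mul_right] at hx
        simpa using he _ x g hx)
  simp only [ContinuousMap.coe_mk] at hF
  obtain ⟨U, hUo, hU, f, hf⟩ := PartialPoint.exists_partial_map F
  refine ⟨U, hUo, fun n v t => ?_, barMap (fun _ : Fin 1 => (1 : G)) default, ?_⟩
  · rw [hU, hF]
    constructor
    · rintro ⟨y, hy⟩
      by_contra h
      exact nomatch (hnone h).symm.trans hy
    · rintro ⟨x, hx⟩
      exact ⟨_, hsome hx⟩
  · have key : ∀ u : U, f u 0 = u ∧ f u 1 = barMap (fun _ : Fin 1 => (1 : G)) default := by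
      intro u
      obtain ⟨n, v, t, hu'⟩ := exists_barMap_eq u.1
      have h1 := hf u
      rw [← hu', hF] at h1
      by_cases h : ∃ x, W (cost c v t) x
      · obtain ⟨x, hx⟩ := h
        rw [← Option.some.inj ((hsome hx).symm.trans h1), coneMap_zero, coneMap_one]
        exact ⟨hu', rfl⟩
      · exact nomatch (hnone h).symm.trans h1
    exact ⟨{
      toFun := fun p => f p.2 p.1
      continuous_toFun := by
        have := ContinuousMap.continuous_uncurry_of_continuous f
        exact this.comp (continuous_swap)
      map_zero_left := fun u => (key u).1
      map_one_left := fun u => (key u).2 }⟩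

end Realization

/-! ### Convexity and minima on the Cayley tree -/

namespace FreeGroup

variable {α : Type}

section

variable [DecidableEq α]

/-- Without cancellation at the junction, the concatenated word is already reduced. -/
theorem norm_mul_eq_add {p v : FreeGroup α}
    (h : ∀ a ∈ p.toWord.getLast?, ∀ b ∈ v.toWord.head?, a.1 = b.1 → a.2 = b.2) :
    norm (p * v) = norm p + norm v := by
  have hr : IsReduced (p.toWord ++ v.toWord) :=
    List.isChain_append.2 ⟨isReduced_toWord, isReduced_toWord, h⟩
  rw [norm, toWord_mul, hr.reduce_eq, List.length_append]
  rfl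

/-- Every vertex of a path between two nonadjacent points of the Cayley tree satisfies the
inequality of Stewart's theorem. -/
theorem exists_stewart_le {x y : FreeGroup α} (hxy : x ≠ y)
    (h₁ : ∀ a, y ≠ of a * x) (h₂ : ∀ a, x ≠ of a * y) :
    ∃ (z : FreeGroup α) (i j : ℝ), 0 < i ∧ 0 < j ∧ ∀ v : FreeGroup α,
      (i + j) * ((norm (z * v⁻¹) : ℝ) ^ 2 + i * j) ≤
        j * (norm (x * v⁻¹) : ℝ) ^ 2 + i * (norm (y * v⁻¹) : ℝ) ^ 2 := by
  rcases hw : (x * y⁻¹).toWord with _ | ⟨a, _ | ⟨b, L⟩⟩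
  · rw [toWord_eq_nil_iff, mul_inv_eq_one] at hw
    exact absurd hw hxy
  · rcases a with ⟨a, _ | _⟩
    · refine absurd ?_ (h₁ a)
      have : x * y⁻¹ = (of a)⁻¹ := by rw [← mk_toWord (x := x * y⁻¹), hw]; rfl
      rw [← mul_inv_eq_iff_eq_mul, ← inv_inj, ← this]
      group
    · refine absurd ?_ (h₂ a)
      rw [← mul_inv_eq_iff_eq_mul, ← mk_toWord (x := x * y⁻¹), hw]
      rfl
  · have hred : IsReduced (a :: b :: L) := hw ▸ isReduced_toWord
    rw [isReduced_cons_cons] at hred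
    set p : FreeGroup α := mk [a] with hp
    set q : FreeGroup α := (mk (b :: L))⁻¹ with hq
    set z : FreeGroup α := q⁻¹ * y with hz
    have hpw : p.toWord = [a] := by rw [hp, toWord_mk, IsReduced.reduce_eq IsReduced.singleton]
    have hqw : q.toWord = invRev L ++ [(b.1, !b.2)] := by
      rw [hq, toWord_inv, toWord_mk, hred.2.reduce_eq]
      simp [invRev]
    have hx : x = p * z := by
      rw [hz, ← mul_assoc, ← mul_inv_eq_iff_eq_mul, ← mk_toWord (x := x * y⁻¹), hw, hp, hq,
        inv_inv, mul_mk]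
      rfl
    have hy : y = q * z := by rw [hz, mul_inv_cancel_left]
    have hpn : norm p = 1 := by rw [norm, hpw]; rfl
    have hqn : 1 ≤ norm q := by rw [norm, hqw]; simp
    refine ⟨z, norm p, norm q, by rw [hpn]; norm_num, by exact_mod_cast hqn, fun v => ?_⟩
    have hxu : x * v⁻¹ = p * (z * v⁻¹) := by rw [hx, mul_assoc]
    have hyu : y * v⁻¹ = q * (z * v⁻¹) := by rw [← mul_assoc, ← hy]
    rw [hxu, hyu]
    generalize z * v⁻¹ = u
    have tri : ∀ r : FreeGroup α, norm u ≤ norm r + norm (r * u) ∧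
        norm r ≤ norm u + norm (r * u) := by
      intro r
      constructor
      · calc norm u = norm (r⁻¹ * (r * u)) := by rw [inv_mul_cancel_left]
          _ ≤ norm r⁻¹ + norm (r * u) := norm_mul_le _ _
          _ = _ := by rw [norm_inv_eq]
      · calc norm r = norm (r * u * u⁻¹) := by rw [mul_inv_cancel_right]
          _ ≤ norm (r * u) + norm u⁻¹ := norm_mul_le _ _
          _ = _ := by rw [norm_inv_eq, add_comm]
    -- Since `B ^ 2 ≥ (D - j) ^ 2`, the right side is at least `j * (i + D) ^ 2 + i * (D - j) ^ 2`,
    -- which equals the left side.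
    have stewart : ∀ {i j A B D : ℝ}, 0 ≤ i → 0 ≤ B → A = i + D → D ≤ j + B → j ≤ D + B →
        (i + j) * (D ^ 2 + i * j) ≤ j * A ^ 2 + i * B ^ 2 := by
      intro i j A B D hi hB hA h1 h2
      have : (D - j) ^ 2 ≤ B ^ 2 := sq_le_sq' (by linarith) (by linarith)
      subst hA
      nlinarith [mul_le_mul_of_nonneg_left this hi]
    -- The geodesics from `z` to `x` and to `y` leave in different directions, so the one from `z`
    -- to `v` can share an initial edge with at most one of them.
    have hor : norm (p * u) = norm p + norm u ∨ norm (q * u) = norm q + norm u := by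
      by_contra! hcon
      obtain ⟨hc1, hc2⟩ := hcon
      have h1 := mt norm_mul_eq_add hc1
      have h2 := mt norm_mul_eq_add hc2
      simp only [hpw, hqw, List.getLast?_singleton, List.getLast?_append, Option.mem_def] at h1 h2
      rcases hu : u.toWord.head? with _ | f
      · simp [hu] at h1
      · simp [hu] at h1 h2
        refine absurd (hred.1 ?_) ?_
        · rw [h1.1, h2.1]
        · grind
    obtain ⟨hp1, hp2⟩ := tri p
    obtain ⟨hq1, hq2⟩ := tri q
    rcases hor with h | h
    · exact stewart (by positivity) (by positivity) (by exact_mod_cast h) (by exact_mod_cast hq1)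
        (by exact_mod_cast hq2)
    · have := stewart (i := norm q) (j := norm p) (A := norm (q * u)) (B := norm (p * u))
        (D := norm u) (by positivity) (by positivity) (by exact_mod_cast h)
        (by exact_mod_cast hp1) (by exact_mod_cast hp2)
      linarith

theorem finite_norm_le [Finite α] (N : ℕ) : {g : FreeGroup α | norm g ≤ N}.Finite :=
  (List.finite_length_le (α × Bool) N).preimage toWord_injective.injOn

end

/-- The sum of the exponents of the letters of a word. -/
def exponentSum : FreeGroup α →* Multiplicative ℤ :=
  lift fun _ => Multiplicative.ofAdd 1

theorem exponentSum_of (a : α) : exponentSum (of a) = Multiplicative.ofAdd 1 := by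
  simp [exponentSum]

theorem toAdd_exponentSum_of_mul (a : α) (x : FreeGroup α) :
    (exponentSum (of a * x)).toAdd = 1 + (exponentSum x).toAdd := by
  simp [exponentSum_of]

/-- `x` is the only minimum of `f`. -/
def IsVertexMin (f : FreeGroup α → ℝ) (x : FreeGroup α) : Prop :=
  ∀ z, z ≠ x → f x < f z

/-- The least two values of `f` are attained at `x` and its neighbour in the direction of a
generator, and nowhere else. -/
def IsEdgeMin (f : FreeGroup α → ℝ) (x : FreeGroup α) : Prop :=
  ∃ a, ∀ z, z ≠ x ∧ z ≠ of a * x → f x < f z ∧ f (of a * x) < f z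

theorem IsVertexMin.eq {f : FreeGroup α → ℝ} {x y : FreeGroup α} (hx : IsVertexMin f x)
    (hy : IsVertexMin f y) : x = y := by
  by_contra h
  exact lt_asymm (hx y (Ne.symm h)) (hy x h)

/-- If the initial ends differed, each would be the terminal end of the other edge, and the exponent
sum would increase by one in both directions. -/
theorem IsEdgeMin.eq {f : FreeGroup α → ℝ} {x y : FreeGroup α} (hx : IsEdgeMin f x)
    (hy : IsEdgeMin f y) : x = y := by
  have key : ∀ {x y : FreeGroup α} {a b : α},
      (∀ z, z ≠ x ∧ z ≠ of a * x → f x < f z ∧ f (of a * x) < f z) →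
      (∀ z, z ≠ y ∧ z ≠ of b * y → f y < f z ∧ f (of b * y) < f z) →
      x ≠ y → y = of a * x := by
    intro x y a b hx hy hne
    by_contra hya
    obtain ⟨h1, h2⟩ := hx y ⟨hne.symm, hya⟩
    by_cases hxb : x = of b * y
    · refine lt_asymm h2 (hy _ ⟨fun h => hya h.symm, ?_⟩).1
      rw [← hxb]
      exact fun h => of_ne_one a (mul_eq_right.1 h)
    · exact lt_asymm h1 (hy x ⟨hne, hxb⟩).1
  obtain ⟨a, hx⟩ := hx
  obtain ⟨b, hy⟩ := hy
  by_contra hne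
  have h1 := toAdd_exponentSum_of_mul a x
  have h2 := toAdd_exponentSum_of_mul b y
  rw [← key hx hy hne] at h1
  rw [← key hy hx (Ne.symm hne)] at h2
  lia

theorem IsVertexMin.translate {f : FreeGroup α → ℝ} {x : FreeGroup α} (hx : IsVertexMin f x)
    (g : FreeGroup α) : IsVertexMin (fun y => f (y * g)) (x * g⁻¹) := by
  intro z hz
  simpa using hx (z * g) fun h => hz (by rw [← h, mul_inv_cancel_right])

theorem IsEdgeMin.translate {f : FreeGroup α → ℝ} {x : FreeGroup α} (hx : IsEdgeMin f x)
    (g : FreeGroup α) : IsEdgeMin (fun y => f (y * g)) (x * g⁻¹) := by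
  obtain ⟨a, hx⟩ := hx
  refine ⟨a, fun z hz => ?_⟩
  simpa [mul_assoc] using hx (z * g) ⟨fun h => hz.1 (by rw [← h, mul_inv_cancel_right]),
    fun h => hz.2 (by rw [← mul_assoc, ← h, mul_inv_cancel_right])⟩

/-- A function on a free group that has a minimum, and any two of whose minima are adjacent in
the Cayley tree, has a unique minimum or an edge of minima. -/
theorem exists_isVertexMin_or_isEdgeMin {f : FreeGroup α → ℝ} (hmin : ∃ x, ∀ z, f x ≤ f z)
    (hadj : ∀ x y, x ≠ y → (∀ z, f x ≤ f z) → (∀ z, f y ≤ f z) →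
      (∃ a, y = of a * x) ∨ ∃ a, x = of a * y) :
    (∃ x, IsVertexMin f x) ∨ ∃ x, IsEdgeMin f x := by
  obtain ⟨x, hx⟩ := hmin
  have edge : ∀ {x : FreeGroup α} {a : α}, (∀ z, f x ≤ f z) → (∀ z, f (of a * x) ≤ f z) →
      IsEdgeMin f x := by
    intro x a hx hy
    refine ⟨a, fun z hz => ?_⟩
    by_contra hcon
    have hzm : ∀ w, f z ≤ f w := by
      intro w
      by_contra! hzw
      exact hcon ⟨(hx w).trans_lt hzw, (hy w).trans_lt hzw⟩
    -- A third minimum would form a triangle with `x` and `of a * x`; the parity of the exponent sum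
    -- forbids this.
    have h0 := toAdd_exponentSum_of_mul a x
    have h1 : (exponentSum z).toAdd = 1 + (exponentSum x).toAdd ∨
        (exponentSum x).toAdd = 1 + (exponentSum z).toAdd := by
      rcases hadj x z hz.1.symm hx hzm with ⟨b, hb⟩ | ⟨b, hb⟩
      · exact Or.inl (by rw [hb, toAdd_exponentSum_of_mul])
      · exact Or.inr (by rw [hb, toAdd_exponentSum_of_mul])
    have h2 : (exponentSum z).toAdd = 1 + (exponentSum (of a * x)).toAdd ∨
        (exponentSum (of a * x)).toAdd = 1 + (exponentSum z).toAdd := by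
      rcases hadj (of a * x) z hz.2.symm hy hzm with ⟨b, hb⟩ | ⟨b, hb⟩
      · exact Or.inl (by rw [hb, toAdd_exponentSum_of_mul])
      · exact Or.inr (by rw [hb, toAdd_exponentSum_of_mul])
    lia
  by_cases hv : IsVertexMin f x
  · exact Or.inl ⟨x, hv⟩
  · right
    simp only [IsVertexMin, not_forall, not_lt] at hv
    obtain ⟨y, hyx, hy⟩ := hv
    have hym : ∀ z, f y ≤ f z := fun z => hy.trans (hx z)
    rcases hadj x y hyx.symm hx hym with ⟨a, ha⟩ | ⟨a, ha⟩
    · exact ⟨x, edge hx (ha ▸ hym)⟩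
    · exact ⟨y, edge hym (ha ▸ hx)⟩

end FreeGroup

/-! ### Minima of the cost function -/

namespace Realization

open FreeGroup

section

variable {G : Type} [Group G] {c : G → ℝ}

theorem cost_lt_cost {n : ℕ} {v : Fin (n + 1) → G} {x z : G}
    (h : ∀ i, c (x * (v i)⁻¹) < c (z * (v i)⁻¹)) (t : stdSimplex ℝ (Fin (n + 1))) :
    cost c v t x < cost c v t z := by
  obtain ⟨i, hi⟩ : ∃ i, 0 < t i := by
    by_contra! hcon
    have := stdSimplex.sum_eq_one t
    linarith [Finset.sum_nonpos fun i (_ : i ∈ Finset.univ) => hcon i]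
  exact Finset.sum_lt_sum (fun i _ => mul_le_mul_of_nonneg_left (h i).le (t.2.1 i))
    ⟨i, Finset.mem_univ i, mul_lt_mul_of_pos_left (h i) hi⟩

theorem finite_exists_le (hc : ∀ r, {g | c g ≤ r}.Finite) {n : ℕ} (v : Fin (n + 1) → G) (x : G) :
    {z | ∃ i, c (z * (v i)⁻¹) ≤ c (x * (v i)⁻¹)}.Finite := by
  have : {z | ∃ i, c (z * (v i)⁻¹) ≤ c (x * (v i)⁻¹)} =
      ⋃ i, (fun z => z * (v i)⁻¹) ⁻¹' {g | c g ≤ c (x * (v i)⁻¹)} := by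
    ext z
    simp only [Set.mem_iUnion]
    rfl
  rw [this]
  exact Set.finite_iUnion fun i => (hc _).preimage (mul_left_injective _).injOn

/-- Outside a finite set independent of `t`, each `z` is costlier than `x` at every `v i`; only
finitely many strict inequalities remain. -/
theorem isOpen_forall_cost_lt (hc : ∀ r, {g | c g ≤ r}.Finite) {n : ℕ} (v : Fin (n + 1) → G)
    (x : G) (P : G → Prop) : IsOpen {t | ∀ z, P z → cost c v t x < cost c v t z} := by
  have : {t | ∀ z, P z → cost c v t x < cost c v t z} =
      ⋂ z ∈ {z | ∃ i, c (z * (v i)⁻¹) ≤ c (x * (v i)⁻¹)},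
        {t | P z → cost c v t x < cost c v t z} := by
    ext t
    simp only [Set.mem_iInter]
    refine ⟨fun h z _ => h z, fun h z hz => ?_⟩
    by_cases hzS : ∃ i, c (z * (v i)⁻¹) ≤ c (x * (v i)⁻¹)
    · exact h z hzS hz
    · push Not at hzS
      exact cost_lt_cost hzS t
  rw [this]
  refine (finite_exists_le hc v x).isOpen_biInter fun z _ => ?_
  by_cases hz : P z
  · simpa [hz] using isOpen_lt (continuous_cost c v x) (continuous_cost c v z)
  · simp [hz]

theorem exists_cost_min (hc : ∀ r, {g | c g ≤ r}.Finite) {n : ℕ} (v : Fin (n + 1) → G)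
    (t : stdSimplex ℝ (Fin (n + 1))) : ∃ x, ∀ z, cost c v t x ≤ cost c v t z := by
  obtain ⟨x, hx, hmin⟩ := Set.exists_min_image _ (cost c v t) (finite_exists_le hc v 1)
    ⟨1, 0, le_rfl⟩
  refine ⟨x, fun z => ?_⟩
  by_cases hz : ∃ i, c (z * (v i)⁻¹) ≤ c (1 * (v i)⁻¹)
  · exact hmin z hz
  · push Not at hz
    exact (hmin 1 ⟨0, le_rfl⟩).trans (cost_lt_cost hz t).le

end

variable {α : Type} [DecidableEq α]

/-- The square of the word length of an element of a free group. -/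
def sqNorm (g : FreeGroup α) : ℝ := (norm g : ℝ) ^ 2

theorem finite_sqNorm_le [Finite α] (r : ℝ) : {g : FreeGroup α | sqNorm g ≤ r}.Finite := by
  refine (finite_norm_le ⌈r⌉₊).subset fun g hg => ?_
  have h1 : (norm g : ℝ) ≤ (norm g : ℝ) ^ 2 := by
    exact_mod_cast Nat.le_self_pow two_ne_zero (norm g)
  exact_mod_cast (h1.trans hg).trans (Nat.le_ceil r)

/-- Averaging the Stewart inequality over the weights puts the cost at `z` at least `i * j > 0`
below the minimum. -/
theorem adjacent_of_cost_min {n : ℕ} (v : Fin (n + 1) → FreeGroup α)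
    (t : stdSimplex ℝ (Fin (n + 1))) {x y : FreeGroup α} (hxy : x ≠ y)
    (hx : ∀ z, cost sqNorm v t x ≤ cost sqNorm v t z)
    (hy : ∀ z, cost sqNorm v t y ≤ cost sqNorm v t z) :
    (∃ a, y = of a * x) ∨ ∃ a, x = of a * y := by
  by_contra! hcon
  obtain ⟨z, i, j, hi, hj, h⟩ := exists_stewart_le hxy hcon.1 hcon.2
  have key : (i + j) * (cost sqNorm v t z + i * j) ≤
      j * cost sqNorm v t x + i * cost sqNorm v t y := by
    calc (i + j) * (cost sqNorm v t z + i * j)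
        = (i + j) * (cost sqNorm v t z + (∑ k, t k) * (i * j)) := by
          rw [stdSimplex.sum_eq_one, one_mul]
      _ = ∑ k, t k * ((i + j) * (sqNorm (z * (v k)⁻¹) + i * j)) := by
          rw [cost, Finset.sum_mul, ← Finset.sum_add_distrib, Finset.mul_sum]
          exact Finset.sum_congr rfl fun k _ => by ring
      _ ≤ ∑ k, t k * (j * sqNorm (x * (v k)⁻¹) + i * sqNorm (y * (v k)⁻¹)) :=
          Finset.sum_le_sum fun k _ => mul_le_mul_of_nonneg_left (h (v k)) (t.2.1 k)
      _ = _ := by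
          rw [cost, cost, Finset.mul_sum, Finset.mul_sum, ← Finset.sum_add_distrib]
          exact Finset.sum_congr rfl fun k _ => by ring
  nlinarith [mul_le_mul_of_nonneg_left (hx z) hj.le, mul_le_mul_of_nonneg_left (hy z) hi.le,
    mul_pos hi hj, mul_pos (add_pos hi hj) (mul_pos hi hj)]

end Realization

/-! ### Upper bound for the category -/

open Realization in
/-- The category of a homomorphism from a free group of finite rank is at most `1`. -/
theorem homCat_freeGroup_le_one {α Λ : Type} [Finite α] [Group Λ] (φ : FreeGroup α →* Λ) :
    homCat φ ≤ 1 := by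
  classical
  obtain ⟨U, hUo, hU, hUn⟩ := exists_isOpen_nullhomotopic (G := FreeGroup α) sqNorm
    FreeGroup.IsVertexMin (fun _ _ _ => FreeGroup.IsVertexMin.eq)
    (fun _ _ g h => FreeGroup.IsVertexMin.translate h g)
    fun n v x => isOpen_forall_cost_lt finite_sqNorm_le v x fun z => z ≠ x
  obtain ⟨V, hVo, hV, hVn⟩ := exists_isOpen_nullhomotopic (G := FreeGroup α) sqNorm
    FreeGroup.IsEdgeMin (fun _ _ _ => FreeGroup.IsEdgeMin.eq)
    (fun _ _ g h => FreeGroup.IsEdgeMin.translate h g)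
    fun n v x => by
      have : {t | FreeGroup.IsEdgeMin (cost sqNorm v t) x} =
          ⋃ a, {t | ∀ z, z ≠ x ∧ z ≠ FreeGroup.of a * x → cost sqNorm v t x < cost sqNorm v t z} ∩
            {t | ∀ z, z ≠ x ∧ z ≠ FreeGroup.of a * x →
              cost sqNorm v t (FreeGroup.of a * x) < cost sqNorm v t z} := by
        ext t
        simp only [Set.mem_iUnion]
        exact exists_congr fun a => ⟨fun h => ⟨fun z hz => (h z hz).1, fun z hz => (h z hz).2⟩,
          fun h z hz => ⟨h.1 z hz, h.2 z hz⟩⟩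
      rw [this]
      exact isOpen_iUnion fun a => (isOpen_forall_cost_lt finite_sqNorm_le v _ _).inter
        (isOpen_forall_cost_lt finite_sqNorm_le v _ _)
  refine sInf_le ⟨1, by simp, ![U, V], ?_, ?_, ?_⟩
  · exact Fin.forall_fin_two.2 ⟨hUo, hVo⟩
  · refine Set.eq_univ_of_forall fun u => ?_
    obtain ⟨n, v, t, rfl⟩ := exists_barMap_eq u
    rw [Set.mem_iUnion]
    rcases FreeGroup.exists_isVertexMin_or_isEdgeMin (exists_cost_min finite_sqNorm_le v t)
      (fun x y => adjacent_of_cost_min v t) with h | h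
    · exact ⟨0, (hU n v t).2 h⟩
    · exact ⟨1, (hV n v t).2 h⟩
  · exact Fin.forall_fin_two.2 ⟨hUn.comp_right (classifyingMap φ),
      hVn.comp_right (classifyingMap φ)⟩

/-! ### Lower bound for the category -/

namespace Realization

variable {G : Type} [Group G]

/-- The map `BG → ℝ/ℤ` induced by a homomorphism `G → ℤ`. -/
theorem exists_circleMap (ψ : G →* Multiplicative ℤ) :
    ∃ F : C(ClassifyingSpace G, AddCircle (1 : ℝ)), ∀ (n : ℕ) (v : Fin (n + 1) → G) t,
      F (barMap v t) = ((∑ i, t i * ((ψ (v i)).toAdd : ℝ) : ℝ) : AddCircle (1 : ℝ)) := by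
  refine exists_classifyingSpace_lift (G := G) (Y := AddCircle (1 : ℝ)) (fun n v =>
    ⟨fun t => ((∑ i, t i * ((ψ (v i)).toAdd : ℝ) : ℝ) : AddCircle (1 : ℝ)), ?_⟩) ?_ ?_
  · refine (AddCircle.continuous_mk' _).comp (continuous_finsetSum _ fun i _ => ?_)
    exact ((continuous_apply i).comp continuous_subtype_val).mul continuous_const
  · intro n m f _ v t
    exact congrArg _ (stdSimplex.sum_map_mul f t fun j => ((ψ (v j)).toAdd : ℝ)).symm
  · intro n v g t
    change ((∑ i, t i * ((ψ (v i * g)).toAdd : ℝ) : ℝ) : AddCircle (1 : ℝ)) =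
      ((∑ i, t i * ((ψ (v i)).toAdd : ℝ) : ℝ) : AddCircle (1 : ℝ))
    simp only [map_mul, toAdd_mul, Int.cast_add, mul_add,
      Finset.sum_add_distrib, ← Finset.sum_mul, stdSimplex.sum_eq_one, one_mul]
    -- The weights sum to `1`, so translation by `g` adds the integer `ψ g`.
    rw [AddCircle.coe_add, add_eq_left]
    exact (AddCircle.coe_eq_zero_iff 1).2 ⟨(ψ g).toAdd, by simp⟩

/-- A null-homotopic map to the circle lifts to the line. -/
theorem exists_real_lift {X : Type*} [TopologicalSpace X] {f : C(X, AddCircle (1 : ℝ))}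
    (hf : f.Nullhomotopic) : ∃ l : C(X, ℝ), ∀ x, (l x : AddCircle (1 : ℝ)) = f x := by
  obtain ⟨y, ⟨H⟩⟩ := hf
  obtain ⟨r, rfl⟩ := QuotientAddGroup.mk_surjective y
  have cov := AddCircle.isCoveringMap_coe (𝕜 := ℝ) 1
  -- The reversed homotopy starts at a constant, which lifts to the constant `r`.
  have h0 : ∀ x, H.symm.toContinuousMap (0, x) =
      ((ContinuousMap.const X r x : ℝ) : AddCircle (1 : ℝ)) :=
    fun x => H.symm.apply_zero x
  refine ⟨(cov.liftHomotopy H.symm.toContinuousMap (ContinuousMap.const X r) h0).comp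
    ⟨fun x => (1, x), by fun_prop⟩, fun x => ?_⟩
  exact (congrFun (cov.liftHomotopy_lifts H.symm.toContinuousMap _ h0) (1, x)).trans
    (H.symm.apply_one x)

/-- The loop `γ` of `g` has winding number `ψ (φ g)` in the circle, whereas a real lift along a
closed loop returns to its initial value. -/
theorem not_nullhomotopic_classifyingMap {H : Type} [Group H] (φ : G →* H)
    (ψ : H →* Multiplicative ℤ) {g : G} (hg : ψ (φ g) ≠ 1) :
    ¬ (classifyingMap φ).Nullhomotopic := by
  intro h
  obtain ⟨F, hF⟩ := exists_circleMap ψ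
  obtain ⟨l, hl⟩ := exists_real_lift (h.comp_right F)
  let γ : C(unitInterval, ClassifyingSpace G) := coneMap g (fun _ : Fin 1 => 1) default
  have hγ : ∀ s, F (classifyingMap φ (γ s)) =
      (((s : ℝ) * ((ψ (φ g)).toAdd : ℝ) : ℝ) : AddCircle (1 : ℝ)) := by
    intro s
    rw [coneMap_apply, classifyingMap_barMap, hF, Fin.sum_univ_two]
    change (((s : ℝ) * ((ψ (φ g)).toAdd : ℝ) +
      (1 - s) * _ * ((ψ (φ 1)).toAdd : ℝ) : ℝ) : AddCircle (1 : ℝ)) = _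
    simp
  have hloop : γ 0 = γ 1 := by rw [coneMap_zero, coneMap_one]
  have cov := AddCircle.isCoveringMap_coe (𝕜 := ℝ) 1
  have heq : (fun s => l (γ s)) =
      fun s : unitInterval => (s : ℝ) * ((ψ (φ g)).toAdd : ℝ) + l (γ 0) := by
    refine cov.eq_of_comp_eq (by fun_prop) (by fun_prop) ?_ 0 (by simp)
    ext s
    simp only [Function.comp_apply, AddCircle.coe_add, hl]
    change F (classifyingMap φ (γ s)) = _ + F (classifyingMap φ (γ 0))
    rw [hγ, hγ]
    simp
  have h1 := congrFun heq 1
  simp only [← hloop] at h1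
  refine hg (Multiplicative.toAdd.injective ?_)
  simpa using h1

end Realization

theorem one_le_homCat {Γ Λ : Type} [Group Γ] [Group Λ] (φ : Γ →* Λ) (ψ : Λ →* Multiplicative ℤ)
    {g : Γ} (hg : ψ (φ g) ≠ 1) : 1 ≤ homCat φ := by
  refine le_sInf ?_
  rintro _ ⟨k, rfl, U, hUo, hU, hUn⟩
  rcases Nat.eq_zero_or_pos k with rfl | hk
  · refine absurd ?_ (Realization.not_nullhomotopic_classifyingMap φ ψ hg)
    have hu : ∀ x, x ∈ U 0 := fun x => by
      have : x ∈ ⋃ i, U i := hU ▸ Set.mem_univ x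
      obtain ⟨i, hi⟩ := Set.mem_iUnion.1 this
      rwa [Fin.fin_one_eq_zero i] at hi
    exact (hUn 0).comp_left ⟨fun x => ⟨x, hu x⟩, by fun_prop⟩
  · exact_mod_cast hk

/-! ### Cohomology of free groups -/

namespace groupCohomology

open Limits

universe u

section FreeGroup

variable {k : Type u} [CommRing k] {α : Type u}

/-- A crossed homomorphism on a free group can be prescribed on the generators. -/
theorem exists_cocycles₁_freeGroup (A : Rep.{u} k (FreeGroup α)) (h : α → A) :
    ∃ f : cocycles₁ A, ∀ a, f (FreeGroup.of a) = h a := by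
  -- A crossed homomorphism is the translation part of an affine action with linear part `A.ρ`, and
  -- such an action can be prescribed freely on generators.
  let Φ : FreeGroup α →* Equiv.Perm A := FreeGroup.lift fun a =>
    { toFun := fun x => A.ρ (FreeGroup.of a) x + h a
      invFun := fun x => A.ρ (FreeGroup.of a)⁻¹ (x - h a)
      left_inv := fun x => by simp
      right_inv := fun x => by simp }
  have hof : ∀ a x, Φ (FreeGroup.of a) x = A.ρ (FreeGroup.of a) x + h a := fun a x => by
    simp [Φ]
  have hΦ : ∀ g x, Φ g x = A.ρ g x + Φ g 0 := by
    intro g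
    induction g using FreeGroup.induction_on with
    | C1 => intro x; simp
    | of a => intro x; rw [hof, hof, map_zero, zero_add]
    | inv_of a ih =>
      intro x
      rw [map_inv, Equiv.Perm.inv_eq_iff_eq, ih, map_add]
      have := ih ((Φ (FreeGroup.of a))⁻¹ 0)
      rw [← Equiv.Perm.mul_apply, mul_inv_cancel, Equiv.Perm.one_apply] at this
      rw [add_assoc, ← this, add_zero, ← Module.End.mul_apply, ← map_mul, mul_inv_cancel, map_one,
        Module.End.one_apply]
    | mul x y hx hy =>
      intro z
      rw [map_mul, map_mul, Equiv.Perm.mul_apply, Equiv.Perm.mul_apply, hy, hx, hx (Φ y 0), map_add,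
        Module.End.mul_apply, add_assoc]
  refine ⟨⟨fun g => Φ g 0, ?_⟩, fun a => ?_⟩
  · rw [mem_cocycles₁_iff]
    intro g g'
    rw [map_mul, Equiv.Perm.mul_apply, hΦ]
  · change Φ (FreeGroup.of a) 0 = h a
    rw [hof, map_zero, zero_add]

theorem cocycles₁_freeGroup_ext {A : Rep.{u} k (FreeGroup α)} {f f' : cocycles₁ A}
    (h : ∀ a, f (FreeGroup.of a) = f' (FreeGroup.of a)) : f = f' := by
  refine cocycles₁_ext fun g => ?_
  induction g using FreeGroup.induction_on with
  | C1 => simp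
  | of a => exact h a
  | inv_of a ih =>
    have h1 := cocycles₁_map_inv f (FreeGroup.of a)
    have h2 := cocycles₁_map_inv f' (FreeGroup.of a)
    rw [ih, ← h2] at h1
    have h3 : ∀ z, A.ρ (FreeGroup.of a)⁻¹ (A.ρ (FreeGroup.of a) z) = z := fun z => by simp
    rw [← h3 (f _), h1, h3]
  | mul x y hx hy =>
    refine ((mem_cocycles₁_iff _).1 f.2 x y).trans (Eq.trans ?_
      ((mem_cocycles₁_iff _).1 f'.2 x y).symm)
    exact congrArg₂ (· + ·) (congrArg (A.ρ x) hy) hx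

/-- Lift the values of a cocycle on the generators through `p`; they extend to a cocycle. -/
theorem epi_map_one_of_freeGroup {A B : Rep.{u} k (FreeGroup α)} (p : A ⟶ B) [Epi p] :
    Epi (map (MonoidHom.id (FreeGroup α)) p 1) := by
  rw [ModuleCat.epi_iff_surjective]
  intro x
  induction x using H1_induction_on with
  | h f =>
    have hp := (Rep.epi_iff_surjective p).1 inferInstance
    choose s hs using fun a => hp (f (FreeGroup.of a))
    obtain ⟨f', hf'⟩ := exists_cocycles₁_freeGroup A s
    refine ⟨H1π A f', ?_⟩
    have h1 := congr($(H1π_comp_map (MonoidHom.id (FreeGroup α)) p) f')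
    refine h1.trans (congrArg (H1π B) (cocycles₁_freeGroup_ext fun a => ?_))
    rw [← hs a, ← hf' a]
    rfl

end FreeGroup

section DimensionShift

variable {k G : Type u} [CommRing k] [Group G]

/-- Every representation embeds in one whose higher cohomology vanishes. -/
theorem exists_mono_isZero (A : Rep.{u} k G) :
    ∃ (I : Rep.{u} k G) (i : A ⟶ I), Mono i ∧ ∀ n, IsZero (groupCohomology I (n + 1)) := by
  -- Coinduce from the trivial subgroup; Shapiro's lemma gives the vanishing.
  refine ⟨_, Rep.resCoindToHom (⊥ : Subgroup G).subtype A _ (𝟙 _), ?_, fun n => ?_⟩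
  · rw [Rep.mono_iff_injective]
    intro x y hxy
    have := congr(($hxy).1 1)
    simpa using this
  · exact (isZero_groupCohomology_succ_of_subsingleton _ n).of_iso (coindIso _ _)

theorem exists_shortExact_isZero (A : Rep.{u} k G) :
    ∃ (I B : Rep.{u} k G) (i : A ⟶ I) (p : I ⟶ B) (w : i ≫ p = 0),
      (ShortComplex.mk i p w).ShortExact ∧ ∀ n, IsZero (groupCohomology I (n + 1)) := by
  obtain ⟨I, i, hi, hI⟩ := exists_mono_isZero A
  exact ⟨I, _, i, cokernel.π i, cokernel.condition i,
    { exact := ShortComplex.exact_cokernel i }, hI⟩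

end DimensionShift

variable {k : Type u} [CommRing k] {α : Type u}

/-- The cohomology of a free group vanishes in degrees greater than `1`. -/
theorem isZero_of_freeGroup (A : Rep.{u} k (FreeGroup α)) (n : ℕ) :
    IsZero (groupCohomology A (n + 2)) := by
  induction n generalizing A with
  | zero =>
    obtain ⟨I, B, i, p, w, hS, hI⟩ := exists_shortExact_isZero A
    -- The connecting map onto `H^2` of `A` is epi, yet vanishes because `H^1` of `p` is epi.
    have h1 := epi_δ_of_isZero hS 1 (hI 1)
    have : Epi p := hS.epi_g
    have h2 : Epi (map (MonoidHom.id (FreeGroup α)) p 1) := epi_map_one_of_freeGroup p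
    have h3 : map (MonoidHom.id (FreeGroup α)) p 1 ≫ δ hS 1 2 rfl = 0 :=
      (mapShortComplex₃ hS (i := 1) rfl).zero
    have h4 : δ hS 1 2 rfl = 0 :=
      (cancel_epi (map (MonoidHom.id (FreeGroup α)) p 1)).1 (h3.trans comp_zero.symm)
    exact IsZero.of_epi_eq_zero _ h4
  | succ n ih =>
    obtain ⟨I, B, i, p, w, hS, hI⟩ := exists_shortExact_isZero A
    have := isIso_δ_of_isZero hS (n + 2) (hI (n + 1)) (hI (n + 2))
    exact (ih B).of_iso (asIso (δ hS (n + 2) (n + 3) rfl)).symm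

end groupCohomology

/-! ### Bounds for the cohomological dimension, and the theorem -/

open groupCohomology in
theorem homCd_freeGroup_le_one {α Λ : Type} [Group Λ] (φ : FreeGroup α →* Λ) : homCd φ ≤ 1 := by
  refine sSup_le ?_
  rintro _ ⟨k, rfl, M, hM⟩
  rcases k with _ | _ | k
  · simp
  · simp
  · exact absurd ((isZero_of_freeGroup _ k).eq_of_tgt _ _) hM

open groupCohomology in
-- With trivial coefficients every 1-coboundary is zero, so the nonzero homomorphism `ψ ∘ φ`
-- represents a nonzero class.
theorem one_le_homCd {Γ Λ : Type} [Group Γ] [Group Λ] (φ : Γ →* Λ) (ψ : Λ →* Multiplicative ℤ)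
    {g : Γ} (hg : ψ (φ g) ≠ 1) : 1 ≤ homCd φ := by
  refine le_sSup ⟨1, by simp, Rep.trivial ℤ Λ ℤ, fun h => hg ?_⟩
  let f : cocycles₁ (Rep.trivial ℤ Λ ℤ) := ⟨fun x => (ψ x).toAdd, by
    rw [mem_cocycles₁_iff]
    intro x y
    change (ψ (x * y)).toAdd = (ψ y).toAdd + (ψ x).toAdd
    rw [map_mul, toAdd_mul, add_comm]⟩
  have h1 := congr($(H1π_comp_map φ (𝟙 (Rep.res φ (Rep.trivial ℤ Λ ℤ)))) f)
  rw [h] at h1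
  have h2 : H1π _ (mapCocycles₁ φ (𝟙 (Rep.res φ (Rep.trivial ℤ Λ ℤ))) f) = 0 := by
    rw [← ModuleCat.comp_apply, ← h1]
    rfl
  rw [H1π_eq_zero_iff] at h2
  obtain ⟨x, hx⟩ := h2
  have h3 := congrFun hx g
  refine Multiplicative.toAdd.injective ?_
  change (ψ (φ g)).toAdd = 0
  refine Eq.trans h3.symm ?_
  change x - x = 0
  exact sub_self x

/-- An epimorphism of free groups of finite ranks, with target of positive rank, has category and
cohomological dimension `1`. -/
theorem mainTheorem5 (n m : ℕ) (hm : 1 ≤ m)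
    (φ : FreeGroup (Fin n) →* FreeGroup (Fin m)) (hφ : Function.Surjective φ) :
    homCat φ = 1 ∧ homCd φ = 1 := by
  obtain ⟨g, hg⟩ := hφ (FreeGroup.of ⟨0, hm⟩)
  have hne : FreeGroup.exponentSum (φ g) ≠ 1 := by
    rw [hg, FreeGroup.exponentSum_of]
    decide
  exact ⟨le_antisymm (homCat_freeGroup_le_one φ) (one_le_homCat φ _ hne),
    le_antisymm (homCd_freeGroup_le_one φ) (one_le_homCd φ _ hne)⟩
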